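/- Let $V$ be a finite-dimensional Euclidean Jordan algebra, i.e. a finite-dimensional real vector space with a bilinear commutative (not necessarily associative) product with identity element $e$, satisfying $x^2(xy)=x(x^2y)$, and with an inner product satisfying $(xy|z)=(x|yz)$. Call $x\in V$ invertible if $xy=e$ for some $y$ in the subalgebra $\mathbb{R}[x]$ generated by $x$ and $e$. Let $\Omega=\{x^2 : x\in V \text{ invertible}\}$ be the symmetric cone of $V$, and let $G(\Omega)=\{g\in GL(V) : g(\Omega)=\Omega\}$. For $a\in\Omega$ with spectral decomposition $a=\sum_j\lambda_jc_j$ (where $c_j^2=c_j$, $c_ic_j=0$ for $i\neq j$, $\sum_jc_j=e$, and all $\lambda_j$ with $c_j\neq0$ are positive) and $p\in\mathbb{R}$, put $a^p=\sum_j\lambda_j^p\,c_j$; this does not depend on the choice of the decomposition. Theorem. For every $g\in G(\Omega)$ and every $p\in\mathbb{R}$ with $|p|>1$ there exists a unique $a\in\Omega$ such that $g(a)=a^p$. -/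

import Mathlib

/-- A Euclidean Jordan algebra: a real commutative Jordan algebra with identity element `1`
(not assumed associative) which carries an inner product `B` with `(x y | z) = (x | y z)`.
Finite-dimensionality is assumed separately, through `[FiniteDimensional ℝ V]`. -/
class IsEuclideanJordanAlgebra (V : Type*) [NonAssocCommRing V] [Module ℝ V] : Prop
    extends IsCommJordan V, IsScalarTower ℝ V V, SMulCommClass ℝ V V where
  exists_inner : ∃ B : LinearMap.BilinForm ℝ V,
    (∀ x y : V, B x y = B y x) ∧ (∀ x : V, x ≠ 0 → 0 < B x x) ∧
      ∀ x y z : V, B (x * y) z = B x (y * z)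

namespace EuclideanJordan

variable {V : Type*} [NonAssocCommRing V] [Module ℝ V] [IsEuclideanJordanAlgebra V]

/-- `x` is invertible if `x y = 1` for some `y ∈ ℝ[x]`, the subalgebra generated by `x` and the
identity element. -/
def IsInvertible (x : V) : Prop :=
  ∃ y ∈ NonUnitalAlgebra.adjoin ℝ ({1, x} : Set V), x * y = 1

variable (V) in
/-- The symmetric cone `Ω = {x² : x invertible}`. -/
def symmetricCone : Set V :=
  {y | ∃ x : V, IsInvertible x ∧ y = x * x}

variable (V) in
/-- The group `G(Ω)` of all invertible linear transformations `g` of `V` with `g(Ω) = Ω`. -/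
def coneAutGroup : Subgroup (V ≃ₗ[ℝ] V) where
  carrier := {g | (g : V → V) '' symmetricCone V = symmetricCone V}
  one_mem' := Set.image_id _
  mul_mem' := by
    intro g h hg hh
    change (fun x => g (h x)) '' symmetricCone V = symmetricCone V
    rw [← Set.image_image (fun x => g x) (fun x => h x)]
    exact (congrArg _ hh).trans hg
  inv_mem' := by
    intro g hg
    change (g.symm : V → V) '' symmetricCone V = symmetricCone V
    have hg' : (g : V → V) '' symmetricCone V = symmetricCone V := hg
    conv_lhs => rw [← hg']
    rw [Set.image_image]
    simp

/-- `x = ∑ λᵢ cᵢ`, where `(cᵢ)` is a complete system of orthogonal idempotents. A Jordan frame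
is the special case of primitive idempotents `cᵢ`. -/
structure IsSpectralDecomposition {ι : Type*} [Fintype ι] (x : V) (l : ι → ℝ) (c : ι → V) :
    Prop where
  idem : ∀ i, c i * c i = c i
  ortho : ∀ i j, i ≠ j → c i * c j = 0
  complete : ∑ i, c i = 1
  eq_sum : x = ∑ i, l i • c i

open Classical in
/-- The functional calculus `f(x) = ∑ f(λᵢ) cᵢ` for `x = ∑ λᵢ cᵢ`. By the spectral theorem every
element of a finite-dimensional Euclidean Jordan algebra has a spectral decomposition, and by
`spectralMap_eq` below the value does not depend on the decomposition that is chosen. -/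
noncomputable def spectralMap (f : ℝ → ℝ) (x : V) : V :=
  if h : ∃ (n : ℕ) (d : (Fin n → ℝ) × (Fin n → V)), IsSpectralDecomposition x d.1 d.2 then
    ∑ i, f (h.choose_spec.choose.1 i) • h.choose_spec.choose.2 i
  else 0

/-- The real power `x ^ p = ∑ λᵢ ^ p cᵢ` of an element `x = ∑ λᵢ cᵢ` of the symmetric cone (there
all spectral values `λᵢ` are positive). -/
noncomputable def rpow (x : V) (p : ℝ) : V :=
  spectralMap (fun t => t ^ p) x

/-- If `x = ∑ λᵢ cᵢ`, then `q(L(x)) 1 = ∑ q(λᵢ) cᵢ` for each polynomial `q`, where `L(x)` is the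
multiplication by `x`. -/
theorem IsSpectralDecomposition.aeval_mulLeft {ι : Type*} [Fintype ι] {x : V} {l : ι → ℝ}
    {c : ι → V} (h : IsSpectralDecomposition x l c) (q : Polynomial ℝ) :
    Polynomial.aeval (LinearMap.mulLeft ℝ x) q 1 = ∑ i, q.eval (l i) • c i := by
  classical
  have hx : ∀ j, x * c j = l j • c j := by
    intro j
    rw [h.eq_sum, Finset.sum_mul, Finset.sum_eq_single j]
    · rw [smul_mul_assoc, h.idem]
    · intro i _ hij
      rw [smul_mul_assoc, h.ortho i j hij, smul_zero]
    · simp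
  have hpow : ∀ n : ℕ, (LinearMap.mulLeft ℝ x ^ n) (1 : V) = ∑ i, l i ^ n • c i := by
    intro n
    induction n with
    | zero => simp [h.complete]
    | succ n ih =>
      rw [pow_succ', Module.End.mul_apply, ih, LinearMap.mulLeft_apply, Finset.mul_sum]
      refine Finset.sum_congr rfl fun i _ => ?_
      rw [mul_smul_comm, hx, smul_smul, pow_succ]
  induction q using Polynomial.induction_on' with
  | add p q hp hq => simp [hp, hq, add_smul, Finset.sum_add_distrib]
  | monomial n a =>
    simp [Polynomial.aeval_monomial, Module.algebraMap_end_apply, hpow, smul_smul, mul_comm]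

/-- `spectralMap f x` can be computed from any spectral decomposition of `x`. -/
theorem spectralMap_eq {ι : Type*} [Fintype ι] (f : ℝ → ℝ) {x : V} {l : ι → ℝ} {c : ι → V}
    (h : IsSpectralDecomposition x l c) : spectralMap f x = ∑ i, f (l i) • c i := by
  classical
  have hex : ∃ (n : ℕ) (d : (Fin n → ℝ) × (Fin n → V)), IsSpectralDecomposition x d.1 d.2 := by
    let e := Fintype.equivFin ι
    refine ⟨Fintype.card ι, (l ∘ e.symm, c ∘ e.symm), ⟨fun i => h.idem _, fun i j hij =>
      h.ortho _ _ (e.symm.injective.ne hij), ?_, ?_⟩⟩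
    · exact (Equiv.sum_comp e.symm c).trans h.complete
    · exact h.eq_sum.trans (Equiv.sum_comp e.symm (fun i => l i • c i)).symm
  rw [spectralMap, dif_pos hex]
  have h' := hex.choose_spec.choose_spec
  set m := hex.choose_spec.choose.1
  set d := hex.choose_spec.choose.2
  let s : Finset ℝ := Finset.univ.image l ∪ Finset.univ.image m
  let q : Polynomial ℝ := Lagrange.interpolate s id f
  have hq : ∀ t ∈ s, q.eval t = f t := fun t ht =>
    Lagrange.eval_interpolate_at_node (v := id) f Function.injective_id.injOn ht
  have e1 := h.aeval_mulLeft q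
  rw [h'.aeval_mulLeft q] at e1
  calc ∑ i, f (m i) • d i = ∑ i, q.eval (m i) • d i :=
        Finset.sum_congr rfl fun i _ => by rw [hq (m i) (by simp [s])]
    _ = ∑ i, q.eval (l i) • c i := e1
    _ = ∑ i, f (l i) • c i :=
        Finset.sum_congr rfl fun i _ => by rw [hq (l i) (by simp [s])]

end EuclideanJordan

set_option linter.unusedSectionVars false

/-! The equation `g a = a ^ p` is equivalent on the cone to `a = (g a) ^ (1/p)`, and the right-hand
side is a strict contraction for Thompson's metric. That metric depends only on the order: `a` and
`b` are within `t` when each is at most `exp t` times the other. A linear map preserving the cone is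
monotone, so `g` does not increase distances. A power with exponent `q`, `0 < |q| < 1`, multiplies
them by at most `|q|`. Banach's argument then yields exactly one fixed point.

The substance lies in the power estimate. For `0 < q < 1` it follows from homogeneity and the
Löwner–Heinz inequality `rpow_mono`, which comes from `coneInv_antitone` through an integral of
resolvents. For negative `q`, inversion is composed in (`ThompsonLE.coneInv`).

Antitonicity of inversion is trivial when the smaller element is `1`. The general case is brought
there by the maps `peirceScale c t`, one idempotent of a spectral decomposition at a time. They
preserve the cone (`peirceScale_mem`) and intertwine with inversion (`coneInv_peirceScale`). Only
the three-eigenvalue Peirce decomposition of a single idempotent is needed, not the fundamental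
formula for quadratic representations.

The order is the one dual to the squares, and `mem_symmetricCone_iff` describes `Ω` as the elements
dominating a positive multiple of `1`. Completeness is proved weakly, by testing against linear
forms (`exists_limit_of_thompsonLE`). -/

namespace EuclideanJordan

/-! ### Power associativity and the spectral theorem. -/

section PowerAssoc

open Polynomial

variable {V : Type*} [NonAssocCommRing V] [Module ℝ V] [IsEuclideanJordanAlgebra V]

/-- The linearized Jordan identity. -/
theorem jordan_linearized (a b c z : V) :
    a * ((b * c) * z) - (b * c) * (a * z) + (b * ((c * a) * z) - (c * a) * (b * z)) +
      (c * ((a * b) * z) - (a * b) * (c * z)) = 0 := by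
  have h : 2 • (a * ((b * c) * z) - (b * c) * (a * z) + (b * ((c * a) * z) - (c * a) * (b * z)) +
      (c * ((a * b) * z) - (a * b) * (c * z))) = 0 :=
    congrArg (fun f : AddMonoid.End V => f z) (two_nsmul_lie_lmul_lmul_add_add_eq_zero a b c)
  rw [← Nat.cast_smul_eq_nsmul ℝ] at h
  exact (smul_eq_zero.mp h).resolve_left (by norm_num)

/-- Multiplication by a power `x ^ n = L(x) ^ n 1` commutes with `L(x)` and `L(x ^ 2)`. -/
theorem commute_mulLeft_pow (x : V) (n : ℕ) :
    Commute (LinearMap.mulLeft ℝ ((LinearMap.mulLeft ℝ x ^ n) 1)) (LinearMap.mulLeft ℝ x) ∧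
    Commute (LinearMap.mulLeft ℝ ((LinearMap.mulLeft ℝ x ^ n) 1)) (LinearMap.mulLeft ℝ (x * x)) := by
  set L := LinearMap.mulLeft ℝ x with hL
  set M := LinearMap.mulLeft ℝ (x * x) with hM
  have hLM : Commute L M := by
    ext z
    have h := jordan_linearized x x x z
    simp only [Module.End.mul_apply, hL, hM, LinearMap.mulLeft_apply]
    have : (3 : ℝ) • (x * (x * x * z) - x * x * (x * z)) = 0 := by
      rw [← h]; module
    exact sub_eq_zero.mp ((smul_eq_zero.mp this).resolve_left (by norm_num))
  -- Move `M` past `L ^ k` and use `M 1 = L ^ 2 1`.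
  have hpow : ∀ k : ℕ, M ((L ^ k) 1) = (L ^ (k + 2)) 1 := by
    intro k
    have h1 : (M * L ^ k) 1 = (L ^ k * M) 1 := by rw [(hLM.symm.pow_right k).eq]
    rw [Module.End.mul_apply, Module.End.mul_apply] at h1
    rw [h1, pow_add, Module.End.mul_apply]
    simp [hL, hM, pow_two]
  induction n using Nat.twoStepInduction with
  | zero =>
    have : LinearMap.mulLeft ℝ ((L ^ 0) (1 : V)) = 1 := by ext; simp
    rw [this]
    exact ⟨Commute.one_left _, Commute.one_left _⟩
  | one =>
    have : LinearMap.mulLeft ℝ ((L ^ 1) (1 : V)) = L := by ext; simp [hL]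
    rw [this]
    exact ⟨Commute.refl _, hLM⟩
  | more k h0 h1 =>
    set Z := LinearMap.mulLeft ℝ ((L ^ k) (1 : V)) with hZ
    set W := LinearMap.mulLeft ℝ ((L ^ (k + 1)) (1 : V)) with hW
    -- The linearized identity at `x, x, y, x ^ k`, read as an operator in `y`, expresses `L(x ^ (k
    -- + 2))` through operators already known to commute with `L` and `M`.
    have key : LinearMap.mulLeft ℝ ((L ^ (k + 2)) (1 : V)) =
        (2 : ℝ) • (W * L) - (2 : ℝ) • (L * Z * L) + M * Z := by
      ext y
      have h := jordan_linearized x x y ((L ^ k) 1)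
      have e1 : (L ^ (k + 1)) (1 : V) = x * (L ^ k) 1 := by
        rw [pow_succ', Module.End.mul_apply]; rfl
      change (L ^ (k + 2)) 1 * y = (2 : ℝ) • ((L ^ (k + 1)) 1 * (x * y)) -
        (2 : ℝ) • (x * ((L ^ k) 1 * (x * y))) + x * x * ((L ^ k) 1 * y)
      have e2 : (L ^ (k + 2)) (1 : V) = x * x * (L ^ k) 1 := (hpow k).symm
      rw [e1, e2]
      generalize (L ^ k) (1 : V) = z at h
      rw [mul_comm y x, mul_comm (x * y) z, mul_comm (x * y) (x * z), mul_comm y (x * x * z),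
        mul_comm y z] at h
      linear_combination (norm := module) h
    rw [key]
    refine ⟨?_, ?_⟩
    · exact (((h1.1.mul_left (Commute.refl L)).smul_left _).sub_left
        ((((Commute.refl L).mul_left h0.1).mul_left (Commute.refl L)).smul_left _)).add_left
        (hLM.symm.mul_left h0.1)
    · exact (((h1.2.mul_left hLM).smul_left _).sub_left
        (((hLM.mul_left h0.2).mul_left hLM).smul_left _)).add_left
        ((Commute.refl M).mul_left h0.2)

/-- Power associativity. -/
theorem aeval_mulLeft_mul (x : V) (p q : ℝ[X]) :
    aeval (LinearMap.mulLeft ℝ x) p 1 * aeval (LinearMap.mulLeft ℝ x) q 1 =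
      aeval (LinearMap.mulLeft ℝ x) (p * q) 1 := by
  have hpow : ∀ m n : ℕ, (LinearMap.mulLeft ℝ x ^ m) (1 : V) * (LinearMap.mulLeft ℝ x ^ n) 1 =
      (LinearMap.mulLeft ℝ x ^ (m + n)) 1 := by
    intro m n
    have h := congrArg (fun f : Module.End ℝ V => f 1)
      ((commute_mulLeft_pow x m).1.pow_right n).eq
    simp only [Module.End.mul_apply, LinearMap.mulLeft_apply, mul_one] at h
    rw [h, ← Module.End.mul_apply, ← pow_add, add_comm]
  induction p using Polynomial.induction_on' with
  | add p p' hp hp' => simp [add_mul, hp, hp']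
  | monomial m a =>
    induction q using Polynomial.induction_on' with
    | add q q' hq hq' => rw [map_add, LinearMap.add_apply, mul_add, hq, hq', mul_add, map_add,
        LinearMap.add_apply]
    | monomial n b =>
      simp [Polynomial.aeval_monomial, Module.algebraMap_end_apply, hpow, smul_smul,
        Polynomial.monomial_mul_monomial, mul_comm a b, smul_mul_assoc, mul_smul_comm]

variable (V) in
/-- A chosen inner product `(x | y)` with `(x y | z) = (x | y z)`. -/
noncomputable def assocForm : LinearMap.BilinForm ℝ V :=
  (IsEuclideanJordanAlgebra.exists_inner (V := V)).choose

theorem assocForm_comm (x y : V) : assocForm V x y = assocForm V y x :=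
  (IsEuclideanJordanAlgebra.exists_inner (V := V)).choose_spec.1 x y

theorem assocForm_self_pos {x : V} (hx : x ≠ 0) : 0 < assocForm V x x :=
  (IsEuclideanJordanAlgebra.exists_inner (V := V)).choose_spec.2.1 x hx

theorem assocForm_mul (x y z : V) : assocForm V (x * y) z = assocForm V x (y * z) :=
  (IsEuclideanJordanAlgebra.exists_inner (V := V)).choose_spec.2.2 x y z

theorem assocForm_mul_left (x y z : V) : assocForm V (x * y) z = assocForm V y (x * z) := by
  rw [mul_comm, assocForm_mul]

theorem assocForm_self_nonneg (x : V) : 0 ≤ assocForm V x x := by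
  by_cases hx : x = 0
  · simp [hx]
  · exact (assocForm_self_pos hx).le

theorem eq_zero_of_assocForm_self {x : V} (hx : assocForm V x x = 0) : x = 0 := by
  by_contra h
  exact (assocForm_self_pos h).ne' hx

/-- Associativity of the form says that `L(x)` is self-adjoint, hence diagonalizable. -/
theorem iSup_eigenspace_mulLeft [FiniteDimensional ℝ V] (x : V) :
    ⨆ μ, Module.End.eigenspace (LinearMap.mulLeft ℝ x) μ = ⊤ := by
  let core : InnerProductSpace.Core ℝ V :=
    { inner := fun a b => assocForm V a b
      conj_inner_symm := fun a b => by simp [assocForm_comm a b]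
      re_inner_nonneg := fun a => by simpa using assocForm_self_nonneg a
      add_left := fun a b c => by simp
      smul_left := fun a b r => by simp
      definite := fun a h => eq_zero_of_assocForm_self h }
  let : NormedAddCommGroup V := core.toNormedAddCommGroup
  let : InnerProductSpace ℝ V := InnerProductSpace.ofCore core.toCore
  have hT : (LinearMap.mulLeft ℝ x).IsSymmetric := fun a b => by
    change assocForm V (x * a) b = assocForm V a (x * b)
    exact assocForm_mul_left x a b
  have h := hT.orthogonalComplement_iSup_eigenspaces_eq_bot
  rwa [Submodule.orthogonal_eq_bot_iff] at h

/-- The spectral theorem. -/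
theorem exists_isSpectralDecomposition [FiniteDimensional ℝ V] (x : V) :
    ∃ (s : Finset ℝ) (c : s → V), IsSpectralDecomposition x (fun i : s => (i : ℝ)) c := by
  classical
  have h1 : (1 : V) ∈ ⨆ μ, Module.End.eigenspace (LinearMap.mulLeft ℝ x) μ := by
    rw [iSup_eigenspace_mulLeft]; trivial
  obtain ⟨f, hf, hsum⟩ := (Submodule.mem_iSup_iff_exists_finsupp _ _).mp h1
  have hx : ∀ μ, x * f μ = μ • f μ := fun μ => by
    simpa using Module.End.mem_eigenspace_iff.mp (hf μ)
  have hq : ∀ q : ℝ[X], aeval (LinearMap.mulLeft ℝ x) q 1 = ∑ i : f.support, q.eval (i : ℝ) • f i := by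
    intro q
    have hpow : ∀ (n : ℕ) (μ : ℝ), (LinearMap.mulLeft ℝ x ^ n) (f μ) = μ ^ n • f μ := by
      intro n μ
      induction n with
      | zero => simp
      | succ n ih => simp [pow_succ', ih, hx, smul_smul, mul_comm]
    have hμ : ∀ μ, aeval (LinearMap.mulLeft ℝ x) q (f μ) = q.eval μ • f μ := by
      intro μ
      induction q using Polynomial.induction_on' with
      | add p q hp hq => simp [hp, hq, add_smul]
      | monomial n a =>
        simp [Polynomial.aeval_monomial, Module.algebraMap_end_apply, hpow, smul_smul, mul_comm]
    rw [← hsum, Finsupp.sum, map_sum, ← Finset.sum_coe_sort]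
    exact Finset.sum_congr rfl fun i _ => hμ i
  -- Lagrange polynomials recover each eigencomponent of `1` as a polynomial in `x`. By power
  -- associativity their values at the nodes then give the idempotent and orthogonality relations.
  let ℓ : ℝ → ℝ[X] := fun μ => Lagrange.basis f.support id μ
  have hbasis : ∀ i j : f.support, (ℓ i).eval (j : ℝ) = if i = j then 1 else 0 := by
    intro i j
    by_cases hij : i = j
    · subst hij
      rw [if_pos rfl]
      exact Lagrange.eval_basis_self Function.injective_id.injOn i.2
    · rw [if_neg hij]
      exact Lagrange.eval_basis_of_ne (v := id) (fun h => hij (Subtype.ext h)) j.2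
  have hfl : ∀ i : f.support, f i = aeval (LinearMap.mulLeft ℝ x) (ℓ i) 1 := by
    intro i
    simp [hq, hbasis]
  refine ⟨f.support, fun i => f i, ⟨fun i => ?_, fun i j hij => ?_, ?_, ?_⟩⟩
  · rw [hfl, aeval_mulLeft_mul, hq, hq]
    simp [hbasis]
  · rw [hfl, hfl, aeval_mulLeft_mul, hq]
    simp only [eval_mul, hbasis]
    refine Finset.sum_eq_zero fun k _ => ?_
    by_cases h : i = k
    · subst h; simp [Ne.symm hij]
    · simp [h]
  · have := hq 1
    simpa using this.symm
  · have := hq X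
    simpa using this

end PowerAssoc

section Order

open Polynomial

variable {V : Type*} [NonAssocCommRing V] [Module ℝ V] [IsEuclideanJordanAlgebra V]

/-! ### Peirce decomposition -/

/-- The polynomial is `t (2t - 1) (t - 1)`, so the only possible eigenvalues of `L(c)` are `0`,
`1/2`, `1`. -/
theorem peirce_cubic {c : V} (hc : c * c = c) (y : V) :
    (2 : ℝ) • (c * (c * (c * y))) - (3 : ℝ) • (c * (c * y)) + c * y = 0 := by
  have h := jordan_linearized c c y c
  rw [hc, mul_comm y c, hc, mul_comm y c, mul_comm (c * y) c] at h
  linear_combination (norm := module) h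

/-- The components of `y` in the eigenspaces of `L(c)` for `1`, `1/2`, `0`. -/
theorem exists_peirce_decomposition {c : V} (hc : c * c = c) (y : V) :
    ∃ y₁ y₂ y₀ : V, y = y₁ + y₂ + y₀ ∧ c * y₁ = y₁ ∧ c * y₂ = (1 / 2 : ℝ) • y₂ ∧ c * y₀ = 0 := by
  have h := peirce_cubic hc y
  -- The Lagrange polynomials of the nodes `1`, `1/2`, `0`, evaluated at `L(c)`.
  refine ⟨(2 : ℝ) • (c * (c * y)) - c * y, (4 : ℝ) • (c * y - c * (c * y)),
    y - (3 : ℝ) • (c * y) + (2 : ℝ) • (c * (c * y)), ?_, ?_, ?_, ?_⟩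
  · module
  all_goals simp only [mul_add, mul_sub, mul_smul_comm]
  · linear_combination (norm := module) h
  · linear_combination (norm := module) (-2 : ℝ) • h
  · linear_combination (norm := module) h

/-- `L(y)` commutes with `L(c)` for `y` in the eigenspace of `L(c)` for `0` or `1`. -/
theorem peirce_mul_left_comm {c y : V} {μ : ℝ} (hc : c * c = c) (hy : c * y = μ • y)
    (hμ : μ = 0 ∨ μ = 1) (z : V) : c * (y * z) = y * (c * z) := by
  have h := jordan_linearized c c y z
  rw [hc, mul_comm y c, hy] at h
  simp only [smul_mul_assoc, mul_smul_comm] at h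
  rcases hμ with rfl | rfl
  · linear_combination (norm := module) -h
  · linear_combination (norm := module) h

/-- This says that `h * k` has no component for the eigenvalue `1/2`. -/
theorem peirce_half_mul_half {c h k : V} (hc : c * c = c) (hh : c * h = (1 / 2 : ℝ) • h)
    (hk : c * k = (1 / 2 : ℝ) • k) : c * (c * (h * k)) = c * (h * k) := by
  have e := jordan_linearized c h k c
  rw [mul_comm k c, hh, hk, mul_comm (h * k) c, hc, mul_comm h c, hh] at e
  simp only [smul_mul_assoc, mul_smul_comm, mul_comm k c, mul_comm h c, hh, hk, mul_comm k h] at e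
  rw [mul_comm (h * k) c] at e
  linear_combination (norm := module) e

/-- Both `L(y)` and `L(z)` commute with `L(c)`, so `c * (y * z)` equals `0` and also `y * z`. -/
theorem peirce_one_mul_zero {c y z : V} (hc : c * c = c) (hy : c * y = y) (hz : c * z = 0) :
    y * z = 0 := by
  have h1 := peirce_mul_left_comm (μ := 1) hc (by rw [hy, one_smul]) (Or.inr rfl) z
  have h2 := peirce_mul_left_comm (μ := 0) hc (by rw [hz, zero_smul]) (Or.inl rfl) y
  rw [hz, mul_zero] at h1
  rw [hy, mul_comm z y, h1] at h2
  exact h2.symm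

theorem IsSpectralDecomposition.mul_eq {ι : Type*} [Fintype ι] {x : V} {l : ι → ℝ} {c : ι → V}
    (h : IsSpectralDecomposition x l c) (j : ι) : x * c j = l j • c j := by
  classical
  rw [h.eq_sum, Finset.sum_mul, Finset.sum_eq_single j]
  · rw [smul_mul_assoc, h.idem]
  · intro i _ hij
    rw [smul_mul_assoc, h.ortho i j hij, smul_zero]
  · simp

theorem IsSpectralDecomposition.of_coeff {ι : Type*} [Fintype ι] {x : V} {l : ι → ℝ} {c : ι → V}
    (h : IsSpectralDecomposition x l c) (m : ι → ℝ) :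
    IsSpectralDecomposition (∑ i, m i • c i) m c :=
  ⟨h.idem, h.ortho, h.complete, rfl⟩

theorem IsSpectralDecomposition.spectralMap {ι : Type*} [Fintype ι] {x : V} {l : ι → ℝ}
    {c : ι → V} (h : IsSpectralDecomposition x l c) (f : ℝ → ℝ) :
    IsSpectralDecomposition (spectralMap f x) (fun i => f (l i)) c :=
  ⟨h.idem, h.ortho, h.complete, spectralMap_eq f h⟩

theorem IsSpectralDecomposition.sum_mul_sum {ι : Type*} [Fintype ι] {x : V} {l : ι → ℝ}
    {c : ι → V} (h : IsSpectralDecomposition x l c) (m n : ι → ℝ) :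
    (∑ i, m i • c i) * ∑ i, n i • c i = ∑ i, (m i * n i) • c i := by
  rw [Finset.mul_sum]
  refine Finset.sum_congr rfl fun i _ => ?_
  rw [mul_smul_comm, (h.of_coeff m).mul_eq, smul_smul, mul_comm]

/-- Elements with a common spectral decomposition operator commute. -/
theorem IsSpectralDecomposition.mul_left_comm {ι : Type*} [Fintype ι] {x : V} {l : ι → ℝ}
    {c : ι → V} (h : IsSpectralDecomposition x l c) (m n : ι → ℝ) (z : V) :
    (∑ i, m i • c i) * ((∑ i, n i • c i) * z) = (∑ i, n i • c i) * ((∑ i, m i • c i) * z) := by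
  classical
  have hc : ∀ i j, c i * (c j * z) = c j * (c i * z) := by
    intro i j
    by_cases hij : i = j
    · rw [hij]
    · exact peirce_mul_left_comm (μ := 0) (h.idem i) (by rw [h.ortho i j hij, zero_smul])
        (Or.inl rfl) z
  simp only [Finset.sum_mul, Finset.mul_sum, smul_mul_assoc, mul_smul_comm]
  simp only [Finset.smul_sum]
  rw [Finset.sum_comm]
  refine Finset.sum_congr rfl fun i _ => Finset.sum_congr rfl fun j _ => ?_
  rw [hc, smul_smul, smul_smul, mul_comm]

/-! ### The order defined by the closed cone of squares -/

/-- `x ≼ y` means that `y - x` lies in the dual cone of the set of squares. -/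
def SqLE (x y : V) : Prop :=
  ∀ u : V, assocForm V x (u * u) ≤ assocForm V y (u * u)

local infix:50 " ≼ " => SqLE

theorem SqLE.refl (x : V) : x ≼ x := fun _ => le_rfl

theorem SqLE.trans {x y z : V} (h : x ≼ y) (h' : y ≼ z) : x ≼ z := fun u => (h u).trans (h' u)

theorem SqLE.add {x y x' y' : V} (h : x ≼ y) (h' : x' ≼ y') : x + x' ≼ y + y' := fun u => by
  simpa using add_le_add (h u) (h' u)

theorem SqLE.smul {x y : V} (h : x ≼ y) {t : ℝ} (ht : 0 ≤ t) : t • x ≼ t • y := fun u => by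
  simpa using mul_le_mul_of_nonneg_left (h u) ht

theorem SqLE.smul_right {x : V} (h : 0 ≼ x) {s t : ℝ} (hst : s ≤ t) : s • x ≼ t • x := fun u => by
  have := h u
  simp only [map_zero, LinearMap.zero_apply] at this
  simpa using mul_le_mul_of_nonneg_right hst this

theorem sqLE_iff_sub {x y : V} : x ≼ y ↔ 0 ≼ y - x := by
  simp [SqLE]

theorem SqLE.neg {x y : V} (h : x ≼ y) : -y ≼ -x := fun u => by simpa using h u

/-- Squares span `V` by polarization: testing `d = x - y` against `(d + 1) ^ 2` leaves only `2 (d |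
d)`. -/
theorem SqLE.antisymm {x y : V} (h : x ≼ y) (h' : y ≼ x) : x = y := by
  have hsq : ∀ u, assocForm V (x - y) (u * u) = 0 := fun u => by
    simpa [sub_eq_zero] using le_antisymm (h u) (h' u)
  have h1 := hsq (x - y + 1)
  rw [show (x - y + 1) * (x - y + 1) = (x - y) * (x - y) + (2 : ℝ) • (x - y) + 1 * 1 by
    simp only [add_mul, mul_add, mul_one, one_mul]; module] at h1
  rw [map_add, map_add, hsq, hsq, map_smul] at h1
  refine sub_eq_zero.mp (eq_zero_of_assocForm_self ?_)
  simpa using h1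

theorem assocForm_mul_self (x u : V) : assocForm V x (u * u) = assocForm V (x * u) u :=
  (assocForm_mul x u u).symm

theorem assocForm_idem {c : V} (hc : c * c = c) (x : V) : assocForm V x c = assocForm V (x * c) c := by
  rw [assocForm_mul, hc]

/-- `L(c)` has no negative eigenvalue. Explicitly `(c | u ^ 2) = |c u| ^ 2 + 4 |w| ^ 2`, where `w =
c u - c (c u)` is a quarter of the `1/2`-component of `u`. -/
theorem sqLE_zero_idem {c : V} (hc : c * c = c) : 0 ≼ c := fun u => by
  have h := peirce_cubic hc u
  set w := c * u - c * (c * u) with hw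
  have hcw : c * w = (1 / 2 : ℝ) • w := by
    simp only [hw, mul_sub]
    linear_combination (norm := module) (-1 / 2 : ℝ) • h
  have h2 : assocForm V w w = assocForm V w (c * u) - assocForm V w (c * (c * u)) := by
    rw [← map_sub]
  have h2' : assocForm V w (c * (c * u)) = (1 / 2) * assocForm V w (c * u) := by
    rw [← assocForm_mul_left, hcw, map_smul, LinearMap.smul_apply, smul_eq_mul]
  have h3 : assocForm V (c * u) u = assocForm V (c * u) (c * u) + assocForm V w u := by
    have : assocForm V (c * (c * u)) u = assocForm V (c * u) (c * u) := assocForm_mul_left _ _ _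
    simp [hw, this]
  have h4 : assocForm V w (c * u) = (1 / 2) * assocForm V w u := by
    rw [← assocForm_mul_left, hcw, map_smul, LinearMap.smul_apply, smul_eq_mul]
  rw [assocForm_mul_self c, h3]
  have h5 := assocForm_self_nonneg (c * u)
  have h6 := assocForm_self_nonneg w
  simp only [map_zero, LinearMap.zero_apply]
  linarith

theorem sqLE_zero_one : 0 ≼ (1 : V) := sqLE_zero_idem (mul_one 1)

theorem sqLE_sum {ι : Type*} [Fintype ι] {c : ι → V} (hc : ∀ i, c i * c i = c i) {l m : ι → ℝ}
    (h : ∀ i, c i ≠ 0 → l i ≤ m i) : ∑ i, l i • c i ≼ ∑ i, m i • c i := fun u => by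
  simp only [map_sum, LinearMap.sum_apply]
  refine Finset.sum_le_sum fun i _ => ?_
  by_cases h0 : c i = 0
  · simp [h0]
  · exact (sqLE_zero_idem (hc i)).smul_right (h i h0) u

theorem IsSpectralDecomposition.le_of_sqLE {ι : Type*} [Fintype ι] {x : V} {l : ι → ℝ}
    {c : ι → V} (h : IsSpectralDecomposition x l c) {t : ℝ} (hx : t • 1 ≼ x) {i : ι}
    (hi : c i ≠ 0) : t ≤ l i := by
  -- The idempotent `c i` is its own square, so it is an admissible test element.
  have := hx (c i)
  rw [assocForm_mul_self, assocForm_mul_self, h.mul_eq] at this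
  simp only [smul_mul_assoc, one_mul, map_smul, LinearMap.smul_apply, smul_eq_mul] at this
  exact le_of_mul_le_mul_right this (assocForm_self_pos hi)

theorem IsSpectralDecomposition.smul_one_eq {ι : Type*} [Fintype ι] {x : V} {l : ι → ℝ}
    {c : ι → V} (h : IsSpectralDecomposition x l c) (t : ℝ) : t • (1 : V) = ∑ i, t • c i := by
  rw [← Finset.smul_sum, h.complete]

theorem exists_pos_le_of_finite {ι : Type*} [Fintype ι] (P : ι → Prop) (l : ι → ℝ)
    (h : ∀ i, P i → 0 < l i) : ∃ ε > 0, ∀ i, P i → ε ≤ l i := by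
  classical
  by_cases hne : (Finset.univ.filter P).Nonempty
  · obtain ⟨j, hj, hmin⟩ := Finset.exists_min_image _ l hne
    exact ⟨l j, h j (by simpa using hj), fun i hi => hmin i (by simpa using hi)⟩
  · exact ⟨1, one_pos, fun i hi => absurd ⟨i, by simpa using hi⟩ hne⟩

theorem exists_sqLE_smul_one [FiniteDimensional ℝ V] (x : V) :
    ∃ K : ℝ, 0 < K ∧ x ≼ K • 1 ∧ -x ≼ K • 1 := by
  obtain ⟨s, c, h⟩ := exists_isSpectralDecomposition x
  refine ⟨∑ i : s, |(i : ℝ)| + 1, by positivity, ?_, ?_⟩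
  · rw [h.smul_one_eq]
    nth_rewrite 1 [h.eq_sum]
    refine sqLE_sum h.idem fun i _ => (le_abs_self _).trans ?_
    have := Finset.single_le_sum (f := fun i : s => |(i : ℝ)|) (fun i _ => abs_nonneg _)
      (Finset.mem_univ i)
    linarith
  · rw [h.smul_one_eq]
    nth_rewrite 1 [h.eq_sum]
    simp only [← Finset.sum_neg_distrib, ← neg_smul]
    refine sqLE_sum h.idem fun i _ => (neg_le_abs _).trans ?_
    have := Finset.single_le_sum (f := fun i : s => |(i : ℝ)|) (fun i _ => abs_nonneg _)
      (Finset.mem_univ i)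
    linarith

/-! ### The symmetric cone described by the order. -/

theorem aeval_mulLeft_mem_adjoin (x : V) (q : ℝ[X]) :
    aeval (LinearMap.mulLeft ℝ x) q 1 ∈ NonUnitalAlgebra.adjoin ℝ ({1, x} : Set V) := by
  have h1 : (1 : V) ∈ NonUnitalAlgebra.adjoin ℝ ({1, x} : Set V) :=
    NonUnitalAlgebra.subset_adjoin ℝ (by simp)
  have hx : x ∈ NonUnitalAlgebra.adjoin ℝ ({1, x} : Set V) :=
    NonUnitalAlgebra.subset_adjoin ℝ (by simp)
  have hpow : ∀ n : ℕ, (LinearMap.mulLeft ℝ x ^ n) (1 : V) ∈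
      NonUnitalAlgebra.adjoin ℝ ({1, x} : Set V) := by
    intro n
    induction n with
    | zero => simpa using h1
    | succ n ih =>
      rw [pow_succ', Module.End.mul_apply]
      exact mul_mem hx ih
  induction q using Polynomial.induction_on' with
  | add p q hp hq =>
    rw [map_add, LinearMap.add_apply]
    exact add_mem hp hq
  | monomial n a =>
    simp only [Polynomial.aeval_monomial, Module.algebraMap_end_apply, Module.End.mul_apply]
    exact SMulMemClass.smul_mem a (hpow n)

/-- Here `v` need not lie in `ℝ[x]`: if `l i = 0`, then `|c i| ^ 2 = (x v | c i) = (v | x c i) = 0`.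
-/
theorem IsSpectralDecomposition.ne_zero_of_mul_eq_one {ι : Type*} [Fintype ι] {x v : V}
    {l : ι → ℝ} {c : ι → V} (h : IsSpectralDecomposition x l c) (hv : x * v = 1) {i : ι}
    (hi : c i ≠ 0) : l i ≠ 0 := by
  intro h0
  have h1 : x * c i = 0 := by rw [h.mul_eq, h0, zero_smul]
  refine hi (eq_zero_of_assocForm_self ?_)
  have : assocForm V (c i) (c i) = assocForm V 1 (c i) := by
    rw [assocForm_idem (h.idem i) 1, one_mul]
  rw [this, ← hv, assocForm_mul_left, h1, map_zero]

theorem IsSpectralDecomposition.mem_symmetricCone {ι : Type*} [Fintype ι] {x : V} {l : ι → ℝ}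
    {c : ι → V} (h : IsSpectralDecomposition x l c) (hl : ∀ i, c i ≠ 0 → 0 < l i) :
    x ∈ symmetricCone V := by
  classical
  have hs : IsSpectralDecomposition (∑ i, √(l i) • c i) (fun i => √(l i)) c := h.of_coeff _
  let s : Finset ℝ := Finset.univ.image fun i => √(l i)
  -- Invertibility asks for an inverse in `ℝ[x]`; interpolating `t⁻¹` at the spectral values
  -- provides one.
  let q : ℝ[X] := Lagrange.interpolate s id fun t => t⁻¹
  have hq : ∀ i, q.eval √(l i) = (√(l i))⁻¹ := fun i =>
    Lagrange.eval_interpolate_at_node (v := id) (fun t : ℝ => t⁻¹) Function.injective_id.injOn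
      (by simp [s])
  refine ⟨∑ i, √(l i) • c i, ⟨_, aeval_mulLeft_mem_adjoin _ q, ?_⟩, ?_⟩
  · rw [hs.aeval_mulLeft, h.sum_mul_sum, ← h.complete]
    refine Finset.sum_congr rfl fun i _ => ?_
    by_cases h0 : c i = 0
    · simp [h0]
    · rw [hq, mul_inv_cancel₀ (Real.sqrt_pos.mpr (hl i h0)).ne', one_smul]
  · rw [h.sum_mul_sum, h.eq_sum]
    refine Finset.sum_congr rfl fun i _ => ?_
    by_cases h0 : c i = 0
    · simp [h0]
    · rw [Real.mul_self_sqrt (hl i h0).le]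

/-- The bridge from squares of invertible elements to the order: `Ω` is the interior of the positive
cone for the order unit `1`. -/
theorem mem_symmetricCone_iff [FiniteDimensional ℝ V] {x : V} :
    x ∈ symmetricCone V ↔ ∃ ε : ℝ, 0 < ε ∧ ε • 1 ≼ x := by
  constructor
  · rintro ⟨y, ⟨v, -, hv⟩, rfl⟩
    obtain ⟨s, c, h⟩ := exists_isSpectralDecomposition y
    obtain ⟨ε, hε, hle⟩ := exists_pos_le_of_finite (fun i => c i ≠ 0)
      (fun i : s => (i : ℝ) * i) fun i hi => mul_self_pos.mpr (h.ne_zero_of_mul_eq_one hv hi)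
    refine ⟨ε, hε, ?_⟩
    rw [h.smul_one_eq]
    have hyy : y * y = ∑ i : s, ((i : ℝ) * i) • c i := by
      conv_lhs => rw [h.eq_sum]
      exact h.sum_mul_sum _ _
    rw [hyy]
    exact sqLE_sum h.idem hle
  · rintro ⟨ε, hε, hx⟩
    obtain ⟨s, c, h⟩ := exists_isSpectralDecomposition x
    exact h.mem_symmetricCone fun i hi => hε.trans_le (h.le_of_sqLE hx hi)

theorem IsSpectralDecomposition.pos_of_mem {ι : Type*} [Fintype ι] [FiniteDimensional ℝ V] {x : V}
    {l : ι → ℝ} {c : ι → V} (h : IsSpectralDecomposition x l c) (hx : x ∈ symmetricCone V) {i : ι}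
    (hi : c i ≠ 0) : 0 < l i := by
  obtain ⟨ε, hε, hle⟩ := mem_symmetricCone_iff.mp hx
  exact hε.trans_le (h.le_of_sqLE hle hi)

section

variable [FiniteDimensional ℝ V]

theorem sqLE_zero_of_mem {x : V} (hx : x ∈ symmetricCone V) : 0 ≼ x := by
  obtain ⟨ε, hε, hle⟩ := mem_symmetricCone_iff.mp hx
  have := sqLE_zero_one (V := V).smul hε.le
  rw [smul_zero] at this
  exact this.trans hle

theorem mem_symmetricCone_of_sqLE {x y : V} (hx : x ∈ symmetricCone V) (hxy : x ≼ y) :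
    y ∈ symmetricCone V := by
  obtain ⟨ε, hε, hle⟩ := mem_symmetricCone_iff.mp hx
  exact mem_symmetricCone_iff.mpr ⟨ε, hε, hle.trans hxy⟩

theorem one_mem_symmetricCone : (1 : V) ∈ symmetricCone V :=
  mem_symmetricCone_iff.mpr ⟨1, one_pos, by rw [one_smul]; exact SqLE.refl _⟩

theorem smul_mem_symmetricCone {x : V} (hx : x ∈ symmetricCone V) {t : ℝ} (ht : 0 < t) :
    t • x ∈ symmetricCone V := by
  obtain ⟨ε, hε, hle⟩ := mem_symmetricCone_iff.mp hx
  exact mem_symmetricCone_iff.mpr ⟨t * ε, mul_pos ht hε, by rw [mul_smul]; exact hle.smul ht.le⟩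

theorem add_mem_symmetricCone {x y : V} (hx : x ∈ symmetricCone V) (hy : 0 ≼ y) :
    x + y ∈ symmetricCone V :=
  mem_symmetricCone_of_sqLE hx (by simpa using (SqLE.refl x).add hy)

/-- A positive element with a product inverse is not on the boundary. This gives the closedness half
of the connectedness argument in `peirceScale_mem`. -/
theorem mem_symmetricCone_of_mul_eq_one {x v : V} (hx : 0 ≼ x) (hv : x * v = 1) :
    x ∈ symmetricCone V := by
  obtain ⟨s, c, h⟩ := exists_isSpectralDecomposition x
  refine h.mem_symmetricCone fun i hi => lt_of_le_of_ne ?_ (h.ne_zero_of_mul_eq_one hv hi).symm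
  exact h.le_of_sqLE (by rwa [zero_smul]) hi

/-- `L(x)` is positive definite for `x` in the cone, so product inverses are unique there without
associativity. -/
theorem mul_left_cancel_of_mem {x v w : V} (hx : x ∈ symmetricCone V) (h : x * v = x * w) :
    v = w := by
  obtain ⟨ε, hε, hle⟩ := mem_symmetricCone_iff.mp hx
  refine sub_eq_zero.mp (eq_zero_of_assocForm_self ?_)
  have h1 := hle (v - w)
  rw [assocForm_mul_self, assocForm_mul_self, mul_sub x, h, sub_self, smul_mul_assoc, one_mul] at h1
  simp only [map_smul, LinearMap.smul_apply, smul_eq_mul, map_zero, LinearMap.zero_apply] at h1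
  exact le_antisymm (nonpos_of_mul_nonpos_right h1 hε) (assocForm_self_nonneg _)

end

end Order

/-! ### Peirce scalings and antitonicity of inversion. -/

section Inversion

open Polynomial

variable {V : Type*} [NonAssocCommRing V] [Module ℝ V] [IsEuclideanJordanAlgebra V]

local infix:50 " ≼ " => SqLE

/-- For an idempotent `c`, the map which is `t ^ 2`, `t`, `1` on the eigenspaces of `L(c)` for
`1`, `1/2`, `0`; it is the quadratic representation of `1 + (t - 1) c`. -/
noncomputable def peirceScale (c : V) (t : ℝ) : V →ₗ[ℝ] V :=
  t ^ 2 • ((2 : ℝ) • LinearMap.mulLeft ℝ c ^ 2 - LinearMap.mulLeft ℝ c) +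
    t • ((4 : ℝ) • (LinearMap.mulLeft ℝ c - LinearMap.mulLeft ℝ c ^ 2)) +
    (1 - (3 : ℝ) • LinearMap.mulLeft ℝ c + (2 : ℝ) • LinearMap.mulLeft ℝ c ^ 2)

theorem peirceScale_apply {c y₁ y₂ y₀ : V} (h₁ : c * y₁ = y₁) (h₂ : c * y₂ = (1 / 2 : ℝ) • y₂)
    (h₀ : c * y₀ = 0) (t : ℝ) :
    peirceScale c t (y₁ + y₂ + y₀) = t ^ 2 • y₁ + t • y₂ + y₀ := by
  simp only [peirceScale, pow_two (LinearMap.mulLeft ℝ c), LinearMap.add_apply,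
    LinearMap.smul_apply, LinearMap.sub_apply, Module.End.mul_apply, LinearMap.mulLeft_apply,
    Module.End.one_apply, mul_add, h₁, h₂, h₀, mul_smul_comm, mul_zero]
  module

theorem peirceScale_inv_apply {c : V} (hc : c * c = c) {t : ℝ} (ht : t ≠ 0) (y : V) :
    peirceScale c t (peirceScale c t⁻¹ y) = y := by
  obtain ⟨y₁, y₂, y₀, rfl, h₁, h₂, h₀⟩ := exists_peirce_decomposition hc y
  rw [peirceScale_apply h₁ h₂ h₀, peirceScale_apply (by rw [mul_smul_comm, h₁])
    (by rw [mul_smul_comm, h₂, smul_comm]) h₀, smul_smul, smul_smul, ← mul_pow,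
    mul_inv_cancel₀ ht, one_pow, one_smul, one_smul]

theorem peirceScale_one {c : V} (hc : c * c = c) (y : V) : peirceScale c 1 y = y := by
  obtain ⟨y₁, y₂, y₀, rfl, h₁, h₂, h₀⟩ := exists_peirce_decomposition hc y
  rw [peirceScale_apply h₁ h₂ h₀, one_pow, one_smul, one_smul]

/-- In the product, `y₁ v₂ + y₂ v₀` is multiplied by `t`, `y₂ v₁ + y₀ v₂` by `t⁻¹`, and the other
nonzero terms by `1`. Both of these sums vanish: their sum is the `1/2`-component of `1`, and
`hcomm` makes them equal. -/
theorem peirceScale_mul_peirceScale_inv {c y v : V} (hc : c * c = c) (hyv : y * v = 1)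
    (hcomm : y * (v * c) = v * (y * c)) {t : ℝ} (ht : t ≠ 0) :
    peirceScale c t y * peirceScale c t⁻¹ v = 1 := by
  obtain ⟨y₁, y₂, y₀, rfl, h₁, h₂, h₀⟩ := exists_peirce_decomposition hc y
  obtain ⟨v₁, v₂, v₀, rfl, k₁, k₂, k₀⟩ := exists_peirce_decomposition hc v
  rw [peirceScale_apply h₁ h₂ h₀, peirceScale_apply k₁ k₂ k₀]
  have c1 {y : V} (hy : c * y = y) : ∀ z, c * (y * z) = y * (c * z) :=
    peirce_mul_left_comm hc (by rw [hy, one_smul]) (Or.inr rfl)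
  have c0 {y : V} (hy : c * y = 0) : ∀ z, c * (y * z) = y * (c * z) :=
    peirce_mul_left_comm hc (by rw [hy, zero_smul]) (Or.inl rfl)
  have z1 : y₁ * v₀ = 0 := peirce_one_mul_zero hc h₁ k₀
  have z2 : y₀ * v₁ = 0 := by rw [mul_comm]; exact peirce_one_mul_zero hc k₁ h₀
  have p11 : c * (y₁ * v₁) = y₁ * v₁ := by rw [c1 h₁, k₁]
  have p00 : c * (y₀ * v₀) = 0 := by rw [c0 h₀, k₀, mul_zero]
  have p12 : c * (y₁ * v₂) = (1 / 2 : ℝ) • (y₁ * v₂) := by rw [c1 h₁, k₂, mul_smul_comm]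
  have p02 : c * (y₀ * v₂) = (1 / 2 : ℝ) • (y₀ * v₂) := by rw [c0 h₀, k₂, mul_smul_comm]
  have p21 : c * (y₂ * v₁) = (1 / 2 : ℝ) • (y₂ * v₁) := by
    rw [mul_comm y₂, c1 k₁, h₂, mul_smul_comm]
  have p20 : c * (y₂ * v₀) = (1 / 2 : ℝ) • (y₂ * v₀) := by
    rw [mul_comm y₂, c0 k₀, h₂, mul_smul_comm]
  have p22 : c * (c * (y₂ * v₂)) = c * (y₂ * v₂) := peirce_half_mul_half hc h₂ k₂
  simp only [add_mul, mul_add, z1, z2] at hyv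
  have e1 := congrArg (c * ·) hyv
  simp only [mul_add, p11, p00, p12, p02, p21, p20, mul_zero, mul_one] at e1
  -- Applying `c` a second time changes only the `1/2`-component, so `e1 - e2` isolates it.
  have e2 := congrArg (c * ·) e1
  simp only [mul_add, p11, p12, p02, p21, p20, p22, mul_zero, mul_smul_comm, hc] at e2
  have hsum : y₁ * v₂ + y₂ * v₀ + (y₂ * v₁ + y₀ * v₂) = 0 := by
    linear_combination (norm := module) (4 : ℝ) • (e1 - e2)
  rw [mul_comm _ c, mul_comm _ c] at hcomm
  simp only [mul_add, h₁, h₂, h₀, k₁, k₂, k₀] at hcomm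
  simp only [add_mul, mul_smul_comm, mul_zero, z1, z2, mul_comm v₁ y₁, mul_comm v₁ y₂,
    mul_comm v₂ y₁, mul_comm v₂ y₂, mul_comm v₀ y₁, mul_comm v₀ y₂] at hcomm
  have hM : y₁ * v₂ + y₂ * v₀ = 0 := by
    linear_combination (norm := module) (1 / 2 : ℝ) • hsum - hcomm
  have hN : y₂ * v₁ + y₀ * v₂ = 0 := by
    linear_combination (norm := module) (1 / 2 : ℝ) • hsum + hcomm
  simp only [add_mul, mul_add, smul_mul_assoc, mul_smul_comm, z1, z2, smul_zero, smul_add,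
    smul_smul]
  have s1 : t⁻¹ ^ 2 * t ^ 2 = 1 := by rw [← mul_pow, inv_mul_cancel₀ ht, one_pow]
  have s2 : t⁻¹ * t ^ 2 = t := by rw [pow_two, inv_mul_cancel_left₀ ht]
  have s3 : t⁻¹ ^ 2 * t = t⁻¹ := by rw [pow_two, mul_assoc, inv_mul_cancel₀ ht, mul_one]
  rw [s1, s2, s3, inv_mul_cancel₀ ht]
  linear_combination (norm := module) hyv + (t - 1) • hM + (t⁻¹ - 1) • hN

variable [FiniteDimensional ℝ V]

/-- The inverse of an element of the symmetric cone. -/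
noncomputable def coneInv (x : V) : V :=
  spectralMap (fun t => t⁻¹) x

theorem mul_coneInv {x : V} (hx : x ∈ symmetricCone V) : x * coneInv x = 1 := by
  obtain ⟨s, c, h⟩ := exists_isSpectralDecomposition x
  rw [coneInv, spectralMap_eq _ h, ← h.complete]
  nth_rewrite 1 [h.eq_sum]
  rw [h.sum_mul_sum]
  refine Finset.sum_congr rfl fun i _ => ?_
  by_cases h0 : c i = 0
  · simp [h0]
  · rw [mul_inv_cancel₀ (h.pos_of_mem hx h0).ne', one_smul]

theorem coneInv_eq {x v : V} (hx : x ∈ symmetricCone V) (hv : x * v = 1) : coneInv x = v :=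
  mul_left_cancel_of_mem hx ((mul_coneInv hx).trans hv.symm)

theorem coneInv_mem {x : V} (hx : x ∈ symmetricCone V) : coneInv x ∈ symmetricCone V := by
  obtain ⟨s, c, h⟩ := exists_isSpectralDecomposition x
  exact (h.spectralMap _).mem_symmetricCone fun i hi => inv_pos.mpr (h.pos_of_mem hx hi)

theorem coneInv_mul_left_comm (x z : V) : x * (coneInv x * z) = coneInv x * (x * z) := by
  obtain ⟨s, c, h⟩ := exists_isSpectralDecomposition x
  rw [coneInv, spectralMap_eq _ h]
  have := h.mul_left_comm (fun i => (i : ℝ)) (fun i => (i : ℝ)⁻¹) z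
  rwa [← h.eq_sum] at this

/-- Connectedness of `(0, ∞)`: the admissible `t` include `1` and form an open set. A positive limit
of admissible parameters gives a positive element with a product inverse, so it is admissible too.
-/
theorem peirceScale_mem {c y : V} (hc : c * c = c) (hy : y ∈ symmetricCone V) {t : ℝ}
    (ht : 0 < t) : peirceScale c t y ∈ symmetricCone V := by
  obtain ⟨y₁, y₂, y₀, hdec, h₁, h₂, h₀⟩ := exists_peirce_decomposition hc y
  have happ : ∀ t, peirceScale c t y = t ^ 2 • y₁ + t • y₂ + y₀ := fun t => by
    rw [hdec, peirceScale_apply h₁ h₂ h₀]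
  let u : Set ℝ := {t | peirceScale c t y ∈ symmetricCone V}
  have hopen : IsOpen u := by
    rw [isOpen_iff_mem_nhds]
    intro t₀ ht₀
    obtain ⟨ε, hε, hle⟩ := mem_symmetricCone_iff.mp ht₀
    have hbound : ∀ x : V, ∃ K : ℝ, ∀ r : ℝ, (-(|r| * K)) • (1 : V) ≼ r • x := by
      intro x
      obtain ⟨K, -, h, h'⟩ := exists_sqLE_smul_one x
      refine ⟨K, fun r => ?_⟩
      rcases le_total 0 r with hr | hr
      · rw [abs_of_nonneg hr]
        convert (h'.smul hr).neg using 1 <;> module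
      · rw [abs_of_nonpos hr]
        convert (h.smul (neg_nonneg.mpr hr)).neg using 1 <;> module
    obtain ⟨K₁, hK₁⟩ := hbound y₁
    obtain ⟨K₂, hK₂⟩ := hbound y₂
    have hcont : Continuous fun t : ℝ => |t ^ 2 - t₀ ^ 2| * K₁ + |t - t₀| * K₂ := by fun_prop
    have hnear := hcont.continuousAt.eventually_lt (x₀ := t₀) continuousAt_const
      (show |t₀ ^ 2 - t₀ ^ 2| * K₁ + |t₀ - t₀| * K₂ < ε by simpa using hε)
    filter_upwards [hnear] with t ht
    refine mem_symmetricCone_iff.mpr ⟨ε - (|t ^ 2 - t₀ ^ 2| * K₁ + |t - t₀| * K₂), by linarith, ?_⟩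
    rw [happ] at hle ⊢
    convert (hle.add (hK₁ (t ^ 2 - t₀ ^ 2))).add (hK₂ (t - t₀)) using 1 <;> module
  have hclosed : closure u ∩ Set.Ioi 0 ⊆ u := by
    rintro t ⟨htu, ht⟩
    have hnn : 0 ≼ peirceScale c t y := by
      intro w
      have hcl : IsClosed {t : ℝ | 0 ≤ assocForm V (peirceScale c t y) (w * w)} := by
        simp only [happ, map_add, map_smul, LinearMap.add_apply, LinearMap.smul_apply]
        exact isClosed_le continuous_const (by fun_prop)
      have hsub : u ⊆ {t : ℝ | 0 ≤ assocForm V (peirceScale c t y) (w * w)} := fun s hs => by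
        simpa using sqLE_zero_of_mem hs w
      simpa using closure_minimal hsub hcl htu
    exact mem_symmetricCone_of_mul_eq_one hnn (peirceScale_mul_peirceScale_inv hc (mul_coneInv hy)
      (coneInv_mul_left_comm y c) (ne_of_gt ht))
  exact isPreconnected_Ioi.subset_of_closure_inter_subset hopen
    ⟨1, one_pos, by simpa [u, peirceScale_one hc] using hy⟩ hclosed ht

theorem coneInv_peirceScale {c y : V} (hc : c * c = c) (hy : y ∈ symmetricCone V) {t : ℝ}
    (ht : 0 < t) : coneInv (peirceScale c t y) = peirceScale c t⁻¹ (coneInv y) :=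
  coneInv_eq (peirceScale_mem hc hy ht) (peirceScale_mul_peirceScale_inv hc (mul_coneInv hy)
    (coneInv_mul_left_comm y c) ht.ne')

/-- A linear map which preserves the symmetric cone is monotone. -/
theorem SqLE.map {x y : V} (h : x ≼ y) (f : V →ₗ[ℝ] V)
    (hf : ∀ z ∈ symmetricCone V, f z ∈ symmetricCone V) : f x ≼ f y := by
  rw [sqLE_iff_sub, ← map_sub]
  rw [sqLE_iff_sub] at h
  intro w
  rw [map_zero, LinearMap.zero_apply]
  set b := assocForm V (f 1) (w * w)
  -- `y - x` is only in the closed cone; adding `ε • 1` moves it into `Ω`, and then `ε → 0`.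
  have key : ∀ ε > 0, 0 ≤ assocForm V (f (y - x)) (w * w) + ε * b := by
    intro ε hε
    have := sqLE_zero_of_mem
      (hf _ (add_mem_symmetricCone (smul_mem_symmetricCone one_mem_symmetricCone hε) h)) w
    simp only [map_zero, LinearMap.zero_apply, map_add, map_smul, LinearMap.add_apply,
      LinearMap.smul_apply, smul_eq_mul] at this
    linarith
  have hlim : Filter.Tendsto (fun ε : ℝ => assocForm V (f (y - x)) (w * w) + ε * b)
      (nhdsWithin 0 (Set.Ioi 0)) (nhds (assocForm V (f (y - x)) (w * w) + 0 * b)) :=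
    (Continuous.tendsto (by fun_prop) 0).mono_left nhdsWithin_le_nhds
  rw [zero_mul, add_zero] at hlim
  exact ge_of_tendsto hlim (eventually_nhdsWithin_of_forall key)

theorem coneInv_one : coneInv (1 : V) = 1 := coneInv_eq one_mem_symmetricCone (mul_one 1)

theorem coneInv_sqLE_one {b : V} (hb : 1 ≼ b) : coneInv b ≼ 1 := by
  obtain ⟨s, c, h⟩ := exists_isSpectralDecomposition b
  rw [coneInv, spectralMap_eq _ h, ← h.complete]
  have := sqLE_sum h.idem (l := fun i => (i : ℝ)⁻¹) (m := fun _ => 1) fun i hi =>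
    inv_le_one_of_one_le₀ (h.le_of_sqLE (t := 1) (by rwa [one_smul]) hi)
  simpa using this

/-- The inversion is antitone on the symmetric cone. -/
theorem coneInv_antitone {a b : V} (ha : a ∈ symmetricCone V) (hab : a ≼ b) :
    coneInv b ≼ coneInv a := by
  classical
  obtain ⟨s, c, h⟩ := exists_isSpectralDecomposition a
  -- Induction on the set of idempotents whose coefficient may differ from `1`; each scaling
  -- normalizes one of them. It moves the upper element as well, so `b` must be quantified.
  have key : ∀ (r : Finset s) (l : s → ℝ) (b : V), (∀ i ∉ r, c i ≠ 0 → l i = 1) →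
      ∑ i, l i • c i ∈ symmetricCone V → ∑ i, l i • c i ≼ b →
      coneInv b ≼ coneInv (∑ i, l i • c i) := by
    intro r
    induction r using Finset.induction_on with
    | empty =>
      intro l b hl _ hlb
      have h1 : ∑ i, l i • c i = 1 := by
        rw [← h.complete]
        refine Finset.sum_congr rfl fun i _ => ?_
        by_cases h0 : c i = 0
        · simp [h0]
        · rw [hl i (by simp) h0, one_smul]
      rw [h1] at hlb ⊢
      rw [coneInv_one]
      exact coneInv_sqLE_one hlb
    | insert j r hj ih =>
      intro l b hl hmem hlb
      by_cases h0 : c j = 0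
      · refine ih l b (fun i hi hci => hl i ?_ hci) hmem hlb
        rw [Finset.mem_insert, not_or]
        exact ⟨fun hij => hci (hij ▸ h0), hi⟩
      · have hlj : 0 < l j := (h.of_coeff l).pos_of_mem hmem h0
        -- The scaling acts by `t ^ 2` on `c j`, hence the square root.
        have ht : 0 < (√(l j))⁻¹ := inv_pos.mpr (Real.sqrt_pos.mpr hlj)
        have hcj : c j * c j = c j := h.idem j
        have hT : peirceScale (c j) (√(l j))⁻¹ (∑ i, l i • c i) =
            ∑ i, Function.update l j 1 i • c i := by
          have hsum : ∀ m : s → ℝ, ∑ i, m i • c i =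
              m j • c j + (0 : V) + ∑ i ∈ Finset.univ.erase j, m i • c i := fun m => by
            rw [add_zero, Finset.add_sum_erase _ (fun i => m i • c i) (Finset.mem_univ j)]
          rw [hsum, hsum (Function.update l j 1), peirceScale_apply]
          · rw [smul_smul, inv_pow, Real.sq_sqrt hlj.le, inv_mul_cancel₀ hlj.ne',
              Function.update_self, smul_zero]
            congr 1
            refine Finset.sum_congr rfl fun i hi => ?_
            rw [Function.update_of_ne (Finset.ne_of_mem_erase hi)]
          · rw [mul_smul_comm, hcj]
          · simp
          · rw [Finset.mul_sum]
            refine Finset.sum_eq_zero fun i hi => ?_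
            rw [mul_smul_comm, h.ortho _ _ (Finset.ne_of_mem_erase hi).symm, smul_zero]
        have hpos : ∀ z ∈ symmetricCone V, peirceScale (c j) (√(l j))⁻¹ z ∈ symmetricCone V :=
          fun z hz => peirceScale_mem hcj hz ht
        have hb : b ∈ symmetricCone V := mem_symmetricCone_of_sqLE hmem hlb
        have hle := ih (Function.update l j 1) (peirceScale (c j) (√(l j))⁻¹ b)
          (fun i hi hci => ?_) (hT ▸ hpos _ hmem) (hT ▸ hlb.map _ hpos)
        · rw [← hT, coneInv_peirceScale hcj hb ht, coneInv_peirceScale hcj hmem ht] at hle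
          have := hle.map _ hpos
          rwa [peirceScale_inv_apply hcj ht.ne', peirceScale_inv_apply hcj ht.ne'] at this
        · by_cases hij : i = j
          · rw [hij, Function.update_self]
          · rw [Function.update_of_ne hij]
            exact hl i (by simp [hij, hi]) hci
  have := key Finset.univ (fun i => (i : ℝ)) b (by simp) (by rwa [← h.eq_sum])
    (by rwa [← h.eq_sum])
  rwa [← h.eq_sum] at this

end Inversion

/-! ### Real powers and the Löwner–Heinz inequality. -/

section Thompson

variable {V : Type*} [NonAssocCommRing V] [Module ℝ V] [IsEuclideanJordanAlgebra V]
  [FiniteDimensional ℝ V]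

local infix:50 " ≼ " => SqLE

/-- Coefficients of zero idempotents are arbitrary; setting them to `1` makes the laws of real
powers apply to every index. -/
theorem exists_pos_isSpectralDecomposition {x : V} (hx : x ∈ symmetricCone V) :
    ∃ (s : Finset ℝ) (l : s → ℝ) (c : s → V), IsSpectralDecomposition x l c ∧ ∀ i, 0 < l i := by
  classical
  obtain ⟨s, c, h⟩ := exists_isSpectralDecomposition x
  refine ⟨s, fun i => if c i = 0 then 1 else (i : ℝ), c, ⟨h.idem, h.ortho, h.complete, ?_⟩,
    fun i => ?_⟩
  · nth_rewrite 1 [h.eq_sum]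
    refine Finset.sum_congr rfl fun i _ => ?_
    by_cases h0 : c i = 0 <;> simp [h0]
  · by_cases h0 : c i = 0
    · simp [h0]
    · simpa [h0] using h.pos_of_mem hx h0

theorem rpow_mem {x : V} (hx : x ∈ symmetricCone V) (p : ℝ) : rpow x p ∈ symmetricCone V := by
  obtain ⟨s, l, c, h, hl⟩ := exists_pos_isSpectralDecomposition hx
  exact (h.spectralMap _).mem_symmetricCone fun i _ => Real.rpow_pos_of_pos (hl i) p

theorem rpow_rpow {x : V} (hx : x ∈ symmetricCone V) (p q : ℝ) :
    rpow (rpow x p) q = rpow x (p * q) := by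
  obtain ⟨s, l, c, h, hl⟩ := exists_pos_isSpectralDecomposition hx
  rw [rpow, rpow, rpow, spectralMap_eq _ h, spectralMap_eq _ h, spectralMap_eq _ (h.of_coeff _)]
  refine Finset.sum_congr rfl fun i _ => ?_
  rw [Real.rpow_mul (hl i).le]

theorem rpow_one' (x : V) : rpow x 1 = x := by
  obtain ⟨s, c, h⟩ := exists_isSpectralDecomposition x
  rw [rpow, spectralMap_eq _ h]
  simp only [Real.rpow_one]
  exact h.eq_sum.symm

theorem coneInv_eq_rpow (x : V) : coneInv x = rpow x (-1) := by
  rw [coneInv, rpow]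
  simp only [Real.rpow_neg_one]

theorem smul_rpow {x : V} (hx : x ∈ symmetricCone V) {t : ℝ} (ht : 0 < t) (p : ℝ) :
    rpow (t • x) p = t ^ p • rpow x p := by
  obtain ⟨s, l, c, h, hl⟩ := exists_pos_isSpectralDecomposition hx
  have h' : IsSpectralDecomposition (t • x) (fun i => t * l i) c :=
    ⟨h.idem, h.ortho, h.complete, by
      nth_rewrite 1 [h.eq_sum]
      simp [Finset.smul_sum, smul_smul]⟩
  rw [rpow, rpow, spectralMap_eq _ h, spectralMap_eq _ h', Finset.smul_sum]
  refine Finset.sum_congr rfl fun i _ => ?_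
  rw [Real.mul_rpow ht.le (hl i).le, smul_smul]

open MeasureTheory in
/-- The integral representation of `a ^ p` for `0 < p < 1`. -/
theorem integral_assocForm_rpow {a : V} (ha : a ∈ symmetricCone V) {p : ℝ} (hp : p ∈ Set.Ioo 0 1)
    (w : V) :
    IntegrableOn (fun t : ℝ => t ^ p * (t⁻¹ * assocForm V 1 w - assocForm V (coneInv (a + t • 1)) w))
      (Set.Ioi 0) ∧
    ∫ t in Set.Ioi 0, t ^ p * (t⁻¹ * assocForm V 1 w - assocForm V (coneInv (a + t • 1)) w) =
      assocForm V (rpow a p) w * ∫ t in Set.Ioi 0, Real.rpowIntegrand₀₁ p t 1 := by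
  obtain ⟨s, l, c, h, hl⟩ := exists_pos_isSpectralDecomposition ha
  -- Pairing with `w` splits the integrand into scalar ones `t ^ p (t⁻¹ - (t + l i)⁻¹)`, whose
  -- integral is `l i ^ p` times a constant.
  have hcongr : Set.EqOn (fun t : ℝ => ∑ i, assocForm V (c i) w * Real.rpowIntegrand₀₁ p t (l i))
      (fun t : ℝ => t ^ p * (t⁻¹ * assocForm V 1 w - assocForm V (coneInv (a + t • 1)) w))
      (Set.Ioi 0) := by
    intro t ht
    have h' : IsSpectralDecomposition (a + t • 1) (fun i => t + l i) c :=
      ⟨h.idem, h.ortho, h.complete, by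
        rw [h.smul_one_eq]
        nth_rewrite 1 [h.eq_sum]
        rw [← Finset.sum_add_distrib]
        exact Finset.sum_congr rfl fun i _ => by rw [add_smul, add_comm]⟩
    simp only [coneInv, spectralMap_eq _ h']
    rw [← h.complete]
    simp only [map_sum, LinearMap.sum_apply, map_smul, LinearMap.smul_apply, smul_eq_mul,
      Real.rpowIntegrand₀₁]
    rw [Finset.mul_sum, ← Finset.sum_sub_distrib, Finset.mul_sum]
    exact Finset.sum_congr rfl fun i _ => by ring
  have hint : ∀ i, IntegrableOn (fun t => assocForm V (c i) w * Real.rpowIntegrand₀₁ p t (l i))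
      (Set.Ioi 0) := fun i =>
    (Real.integrableOn_rpowIntegrand₀₁_Ioi hp (hl i).le).const_mul _
  constructor
  · rw [← integrableOn_congr_fun hcongr measurableSet_Ioi]
    exact integrable_finsetSum _ fun i _ => hint i
  · rw [← setIntegral_congr_fun measurableSet_Ioi hcongr, integral_finsetSum _ fun i _ => hint i,
      rpow, spectralMap_eq _ h]
    simp only [map_sum, LinearMap.sum_apply, map_smul, LinearMap.smul_apply, smul_eq_mul]
    rw [Finset.sum_mul]
    refine Finset.sum_congr rfl fun i _ => ?_
    rw [integral_const_mul, Real.integral_rpowIntegrand₀₁_eq_rpow_mul_const hp (hl i).le]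
    ring

/-- The Löwner–Heinz inequality. -/
theorem rpow_mono {a b : V} (ha : a ∈ symmetricCone V) (hab : a ≼ b) {p : ℝ}
    (hp : p ∈ Set.Ioo 0 1) : rpow a p ≼ rpow b p := by
  intro u
  have hb := mem_symmetricCone_of_sqLE ha hab
  obtain ⟨ia, ea⟩ := integral_assocForm_rpow ha hp (u * u)
  obtain ⟨ib, eb⟩ := integral_assocForm_rpow hb hp (u * u)
  refine le_of_mul_le_mul_right ?_ (Real.integral_rpowIntegrand₀₁_one_pos hp)
  rw [← ea, ← eb]
  refine MeasureTheory.setIntegral_mono_on ia ib measurableSet_Ioi fun t ht => ?_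
  have ht' : (0 : ℝ) < t := ht
  have hmem : a + t • 1 ∈ symmetricCone V := add_mem_symmetricCone ha
    (by simpa using (sqLE_zero_one (V := V)).smul ht'.le)
  have := coneInv_antitone hmem (hab.add (SqLE.refl (t • (1 : V)))) u
  have htp : 0 ≤ t ^ p := Real.rpow_nonneg ht'.le p
  exact mul_le_mul_of_nonneg_left (by linarith) htp

/-! ### Thompson's metric -/

/-- `a` and `b` are at distance at most `t` in Thompson's metric. -/
def ThompsonLE (t : ℝ) (a b : V) : Prop :=
  a ≼ Real.exp t • b ∧ b ≼ Real.exp t • a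

theorem sqLE_exp_smul {x y : V} {t : ℝ} (h : x ≼ Real.exp t • y) : Real.exp (-t) • x ≼ y := by
  have := h.smul (Real.exp_pos (-t)).le
  rwa [smul_smul, ← Real.exp_add, neg_add_cancel, Real.exp_zero, one_smul] at this

theorem ThompsonLE.symm {t : ℝ} {a b : V} (h : ThompsonLE t a b) : ThompsonLE t b a := ⟨h.2, h.1⟩

theorem ThompsonLE.trans {s t : ℝ} {a b c : V} (h : ThompsonLE s a b) (h' : ThompsonLE t b c) :
    ThompsonLE (s + t) a c := by
  constructor
  · rw [Real.exp_add, mul_smul]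
    exact h.1.trans (h'.1.smul (Real.exp_pos s).le)
  · rw [add_comm, Real.exp_add, mul_smul]
    exact h'.2.trans (h.2.smul (Real.exp_pos t).le)

theorem ThompsonLE.mono {s t : ℝ} {a b : V} (h : ThompsonLE s a b) (ha : a ∈ symmetricCone V)
    (hb : b ∈ symmetricCone V) (hst : s ≤ t) : ThompsonLE t a b :=
  ⟨h.1.trans ((sqLE_zero_of_mem hb).smul_right (Real.exp_le_exp.mpr hst)),
    h.2.trans ((sqLE_zero_of_mem ha).smul_right (Real.exp_le_exp.mpr hst))⟩

theorem ThompsonLE.refl (a : V) : ThompsonLE 0 a a := by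
  constructor <;> rw [Real.exp_zero, one_smul] <;> exact SqLE.refl a

theorem exists_thompsonLE {a b : V} (ha : a ∈ symmetricCone V) (hb : b ∈ symmetricCone V) :
    ∃ t, 0 ≤ t ∧ ThompsonLE t a b := by
  have key : ∀ {a b : V}, b ∈ symmetricCone V → ∃ t, 0 ≤ t ∧ a ≼ Real.exp t • b := by
    intro a b hb
    obtain ⟨K, hK, haK, -⟩ := exists_sqLE_smul_one a
    obtain ⟨ε, hε, hle⟩ := mem_symmetricCone_iff.mp hb
    -- `exp s ≥ s` at `s = K / ε` gives `K ≤ exp s * ε`.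
    refine ⟨K / ε, by positivity, haK.trans ?_⟩
    have h1 : K ≤ Real.exp (K / ε) * ε := by
      have := Real.add_one_le_exp (K / ε)
      rw [← div_le_iff₀ hε]
      linarith
    refine ((sqLE_zero_one (V := V)).smul_right h1).trans ?_
    rw [mul_smul]
    exact hle.smul (Real.exp_pos _).le
  obtain ⟨s, hs, h⟩ := key (a := a) hb
  obtain ⟨t, ht, h'⟩ := key (a := b) ha
  refine ⟨max s t, le_max_of_le_left hs, ?_, ?_⟩
  · exact h.trans ((sqLE_zero_of_mem hb).smul_right (Real.exp_le_exp.mpr (le_max_left _ _)))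
  · exact h'.trans ((sqLE_zero_of_mem ha).smul_right (Real.exp_le_exp.mpr (le_max_right _ _)))

/-- Inversion is antitone and homogeneous of degree `-1`, so it exchanges the two inequalities. -/
theorem ThompsonLE.coneInv {t : ℝ} {a b : V} (h : ThompsonLE t a b) (ha : a ∈ symmetricCone V)
    (hb : b ∈ symmetricCone V) : ThompsonLE t (coneInv a) (coneInv b) := by
  have key : ∀ {a b : V}, a ∈ symmetricCone V → b ∈ symmetricCone V → b ≼ Real.exp t • a →
      EuclideanJordan.coneInv a ≼ Real.exp t • EuclideanJordan.coneInv b := by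
    intro a b ha hb h
    have := (coneInv_antitone hb h).smul (Real.exp_pos t).le
    rwa [coneInv_eq_rpow (Real.exp t • a), smul_rpow ha (Real.exp_pos t), ← coneInv_eq_rpow,
      Real.rpow_neg_one, smul_smul, mul_inv_cancel₀ (Real.exp_pos t).ne', one_smul] at this
  exact ⟨key ha hb h.2, key hb ha h.1⟩

/-- `x ↦ x ^ p` is Lipschitz with constant `|p|` for Thompson's metric if `0 < |p| < 1`. -/
theorem ThompsonLE.rpow {t : ℝ} {a b : V} (h : ThompsonLE t a b) (ha : a ∈ symmetricCone V)
    (hb : b ∈ symmetricCone V) {p : ℝ} (hp0 : p ≠ 0) (hp1 : |p| < 1) :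
    ThompsonLE (|p| * t) (rpow a p) (rpow b p) := by
  have key : ∀ {a b : V} {p : ℝ}, p ∈ Set.Ioo 0 1 → a ∈ symmetricCone V → b ∈ symmetricCone V →
      ThompsonLE t a b →
      ThompsonLE (p * t) (EuclideanJordan.rpow a p) (EuclideanJordan.rpow b p) := by
    intro a b p hp ha hb h
    have h1 := rpow_mono ha h.1 hp
    have h2 := rpow_mono hb h.2 hp
    rw [smul_rpow hb (Real.exp_pos t), ← Real.exp_mul, mul_comm t] at h1
    rw [smul_rpow ha (Real.exp_pos t), ← Real.exp_mul, mul_comm t] at h2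
    exact ⟨h1, h2⟩
  rcases lt_or_gt_of_ne hp0 with hneg | hpos
  · rw [abs_of_neg hneg] at hp1 ⊢
    have := key (p := -p) ⟨by linarith, hp1⟩ (coneInv_mem ha) (coneInv_mem hb) (h.coneInv ha hb)
    rw [coneInv_eq_rpow, coneInv_eq_rpow, rpow_rpow ha, rpow_rpow hb] at this
    simpa using this
  · rw [abs_of_pos hpos] at hp1 ⊢
    exact key ⟨hpos, hp1⟩ ha hb h

theorem ThompsonLE.map {t : ℝ} {a b : V} (h : ThompsonLE t a b) (f : V →ₗ[ℝ] V)
    (hf : ∀ z ∈ symmetricCone V, f z ∈ symmetricCone V) : ThompsonLE t (f a) (f b) := by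
  have h1 := h.1.map f hf
  have h2 := h.2.map f hf
  rw [map_smul] at h1 h2
  exact ⟨h1, h2⟩

/-! ### Weak limits, completeness and the contraction principle. -/

theorem sqLE_of_tendsto {ι : Type*} {l : Filter ι} [l.NeBot] {x y : ι → V} {a b : V}
    (hx : ∀ w, Filter.Tendsto (fun n => assocForm V (x n) w) l (nhds (assocForm V a w)))
    (hy : ∀ w, Filter.Tendsto (fun n => assocForm V (y n) w) l (nhds (assocForm V b w)))
    (h : ∀ᶠ n in l, x n ≼ y n) : a ≼ b := fun u =>
  le_of_tendsto_of_tendsto (hx _) (hy _) (h.mono fun _ hn => hn u)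

theorem eq_of_thompsonLE_tendsto_zero {a b : V} {t : ℕ → ℝ}
    (ht : Filter.Tendsto t Filter.atTop (nhds 0)) (h : ∀ n, ThompsonLE (t n) a b) : a = b := by
  have hexp : ∀ (c w : V), Filter.Tendsto (fun n => assocForm V (Real.exp (t n) • c) w)
      Filter.atTop (nhds (assocForm V c w)) := by
    intro c w
    have : Filter.Tendsto (fun n => Real.exp (t n) * assocForm V c w) Filter.atTop
        (nhds (Real.exp 0 * assocForm V c w)) :=
      ((Real.continuous_exp.tendsto 0).comp ht).mul_const _
    simpa using this
  exact SqLE.antisymm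
    (sqLE_of_tendsto (fun w => tendsto_const_nhds) (hexp b) (.of_forall fun n => (h n).1))
    (sqLE_of_tendsto (fun w => tendsto_const_nhds) (hexp a) (.of_forall fun n => (h n).2))

/-- A linear form is bounded by a multiple of the order unit norm. -/
theorem exists_abs_assocForm_le (w : V) : ∃ K : ℝ, 0 ≤ K ∧ ∀ (x : V) (δ : ℝ),
    x ≼ δ • 1 → -x ≼ δ • 1 → |assocForm V x w| ≤ K * δ := by
  obtain ⟨s, c, h⟩ := exists_isSpectralDecomposition w
  refine ⟨∑ i : s, |(i : ℝ)| * assocForm V (c i) (c i),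
    Finset.sum_nonneg fun i _ => mul_nonneg (abs_nonneg _) (assocForm_self_nonneg _), ?_⟩
  intro x δ h1 h2
  have hx : assocForm V x w = ∑ i : s, (i : ℝ) * assocForm V x (c i) := by
    conv_lhs => rw [h.eq_sum]
    simp
  rw [hx, Finset.sum_mul]
  refine (Finset.abs_sum_le_sum_abs _ _).trans (Finset.sum_le_sum fun i _ => ?_)
  rw [abs_mul, mul_assoc]
  refine mul_le_mul_of_nonneg_left ?_ (abs_nonneg _)
  have k1 := h1 (c i)
  have k2 := h2 (c i)
  rw [h.idem i] at k1 k2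
  have k3 : assocForm V (1 : V) (c i) = assocForm V (c i) (c i) := by
    rw [assocForm_idem (h.idem i), one_mul]
  simp only [map_smul, map_neg, LinearMap.smul_apply, LinearMap.neg_apply, smul_eq_mul, k3] at k1 k2
  rw [abs_le]
  constructor <;> linarith

/-- A sequence of the symmetric cone which is geometrically Cauchy for Thompson's metric
converges in this metric. -/
theorem exists_limit_of_thompsonLE {x : ℕ → V} (hx : ∀ n, x n ∈ symmetricCone V) {r t : ℝ}
    (hr0 : 0 < r) (hr1 : r < 1) (ht : 0 ≤ t) (h : ∀ n, ThompsonLE (r ^ n * t) (x n) (x (n + 1))) :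
    ∃ a ∈ symmetricCone V, ∀ n, ThompsonLE (r ^ n * (t / (1 - r))) a (x n) := by
  have h1r : 0 < 1 - r := by linarith
  have hdist : ∀ n k, ThompsonLE (r ^ n * (t / (1 - r))) (x (n + k)) (x n) := by
    intro n k
    -- The exact partial geometric sum, so that the induction closes.
    have : ThompsonLE ((r ^ n - r ^ (n + k)) * (t / (1 - r))) (x (n + k)) (x n) := by
      induction k with
      | zero => simpa using ThompsonLE.refl (x n)
      | succ k ih =>
        change ThompsonLE _ (x (n + k + 1)) _
        convert (h (n + k)).symm.trans ih using 1
        field_simp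
        ring
    refine this.mono (hx _) (hx _) ?_
    have : 0 ≤ r ^ (n + k) := by positivity
    gcongr
    linarith
  set T := t / (1 - r) with hT
  obtain ⟨K, hK, hxK, -⟩ := exists_sqLE_smul_one (x 0)
  have hbound : ∀ n, x n ≼ (Real.exp T * K) • 1 := by
    intro n
    have := (hdist 0 n).1
    rw [zero_add, pow_zero, one_mul] at this
    rw [mul_smul]
    exact this.trans (hxK.smul (Real.exp_pos T).le)
  -- Turns Thompson distance into order-unit distance: `y - z ≼ (exp s - 1) • z`, and `exp s - 1 ≤ s
  -- * exp s`.
  have hstep : ∀ n, ∀ {y z : V}, y ≼ Real.exp (r ^ n * t) • z → z ≼ (Real.exp T * K) • 1 →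
      y - z ≼ (Real.exp t * t * (Real.exp T * K) * r ^ n) • 1 := by
    intro n y z hyz hz
    have e1 : y - z ≼ (Real.exp (r ^ n * t) - 1) • z := by
      convert hyz.add (SqLE.refl (-z)) using 1 <;> module
    have hrn : 0 ≤ r ^ n * t := by positivity
    have e2 : 0 ≤ Real.exp (r ^ n * t) - 1 := sub_nonneg.mpr (Real.one_le_exp hrn)
    refine (e1.trans (hz.smul e2)).trans ?_
    rw [smul_smul]
    refine sqLE_zero_one.smul_right ?_
    have hle : r ^ n * t ≤ t := mul_le_of_le_one_left ht (pow_le_one₀ hr0.le hr1.le)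
    have e3 : Real.exp (r ^ n * t) - 1 ≤ Real.exp t * (r ^ n * t) := by
      have h1 := Real.add_one_le_exp (-(r ^ n * t))
      have h2 : Real.exp (r ^ n * t) * Real.exp (-(r ^ n * t)) = 1 := by
        rw [← Real.exp_add, add_neg_cancel, Real.exp_zero]
      have h3 := mul_le_mul_of_nonneg_left h1 (Real.exp_pos (r ^ n * t)).le
      have h4 := mul_le_mul_of_nonneg_right (Real.exp_le_exp.mpr hle) hrn
      linarith
    have e4 := mul_le_mul_of_nonneg_right e3 (show 0 ≤ Real.exp T * K by positivity)
    linarith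
  have hcau : ∀ w, ∃ y, Filter.Tendsto (fun n => assocForm V (x n) w) Filter.atTop (nhds y) := by
    intro w
    obtain ⟨C, hC, hCw⟩ := exists_abs_assocForm_le w
    refine cauchySeq_tendsto_of_complete (cauchySeq_of_le_geometric r
      (C * (Real.exp t * t * (Real.exp T * K))) hr1 fun n => ?_)
    rw [Real.dist_eq, ← LinearMap.sub_apply, ← map_sub, mul_assoc]
    refine hCw _ _ (hstep n (h n).1 (hbound _)) ?_
    rw [neg_sub]
    exact hstep n (h n).2 (hbound _)
  choose f hf using hcau
  -- The pointwise limit of the forms `(x n | ·)` is linear; nondegeneracy represents it by the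
  -- element `a`.
  let φ : Module.Dual ℝ V := linearMapOfTendsto (l := Filter.atTop) f (fun n => assocForm V (x n))
    (tendsto_pi_nhds.mpr hf)
  have hnd : (assocForm V).Nondegenerate := by
    refine ⟨fun a ha => eq_zero_of_assocForm_self (ha a), fun a ha =>
      eq_zero_of_assocForm_self (ha a)⟩
  let a : V := ((assocForm V).toDual hnd).symm φ
  have ha : ∀ w, Filter.Tendsto (fun n => assocForm V (x n) w) Filter.atTop
      (nhds (assocForm V a w)) := by
    intro w
    rw [LinearMap.BilinForm.apply_toDual_symm_apply]
    exact hf w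
  have hsm : ∀ (s : ℝ) (w : V), Filter.Tendsto (fun n => assocForm V (s • x n) w) Filter.atTop
      (nhds (assocForm V (s • a) w)) := by
    intro s w
    simpa using (ha w).const_mul s
  have hlim : ∀ n, ThompsonLE (r ^ n * T) a (x n) := by
    intro n
    have hev : ∀ᶠ m in Filter.atTop, ThompsonLE (r ^ n * T) (x m) (x n) := by
      filter_upwards [Filter.eventually_ge_atTop n] with m hm
      obtain ⟨k, rfl⟩ := Nat.exists_eq_add_of_le hm
      exact hdist n k
    exact ⟨sqLE_of_tendsto ha (fun w => tendsto_const_nhds) (hev.mono fun m hm => hm.1),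
      sqLE_of_tendsto (fun w => tendsto_const_nhds) (hsm _) (hev.mono fun m hm => hm.2)⟩
  exact ⟨a, mem_symmetricCone_of_sqLE (smul_mem_symmetricCone (hx 0) (Real.exp_pos _))
    (sqLE_exp_smul (hlim 0).2), hlim⟩

/-- The contraction principle for Thompson's metric. -/
theorem existsUnique_fixedPoint_of_thompson {F : V → V}
    (hF : ∀ x ∈ symmetricCone V, F x ∈ symmetricCone V) {r : ℝ} (hr0 : 0 < r) (hr1 : r < 1)
    (hlip : ∀ a ∈ symmetricCone V, ∀ b ∈ symmetricCone V, ∀ t, ThompsonLE t a b →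
      ThompsonLE (r * t) (F a) (F b)) :
    ∃! a : V, a ∈ symmetricCone V ∧ F a = a := by
  have hgeom : ∀ C : ℝ, Filter.Tendsto (fun n : ℕ => r ^ n * C) Filter.atTop (nhds 0) := fun C => by
    simpa using (tendsto_pow_atTop_nhds_zero_of_lt_one hr0.le hr1).mul_const C
  have hmem : ∀ n, F^[n] 1 ∈ symmetricCone V := by
    intro n
    induction n with
    | zero => exact one_mem_symmetricCone
    | succ n ih => rw [Function.iterate_succ_apply']; exact hF _ ih
  obtain ⟨t, ht, h0⟩ := exists_thompsonLE (hmem 0) (hmem 1)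
  have hseq : ∀ n, ThompsonLE (r ^ n * t) (F^[n] 1) (F^[n + 1] 1) := by
    intro n
    induction n with
    | zero => simpa using h0
    | succ n ih =>
      have := hlip _ (hmem n) _ (hmem (n + 1)) _ ih
      rwa [← Function.iterate_succ_apply' F, ← Function.iterate_succ_apply' F, ← mul_assoc,
        ← pow_succ'] at this
  obtain ⟨a, ha, hlim⟩ := exists_limit_of_thompsonLE hmem hr0 hr1 ht hseq
  have hFa : F a = a := by
    set T := t / (1 - r)
    -- Pass through the iterate `n + 1`, within `r ^ n * (r * T)` of both `F a` and `a`.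
    refine eq_of_thompsonLE_tendsto_zero (hgeom (r * T + r * T)) fun n => ?_
    have h1 := hlip _ ha _ (hmem n) _ (hlim n)
    rw [← Function.iterate_succ_apply' F] at h1
    convert h1.trans (hlim (n + 1)).symm using 1
    ring
  refine ⟨a, ⟨ha, hFa⟩, ?_⟩
  rintro b ⟨hb, hFb⟩
  obtain ⟨s, -, hs⟩ := exists_thompsonLE hb ha
  refine eq_of_thompsonLE_tendsto_zero (hgeom s) fun n => ?_
  induction n with
  | zero => simpa using hs
  | succ n ih =>
    have := hlip _ hb _ ha _ ih
    rwa [hFa, hFb, ← mul_assoc, ← pow_succ'] at this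

end Thompson

end EuclideanJordan

theorem mainTheorem5 {V : Type*} [NonAssocCommRing V] [Module ℝ V] [FiniteDimensional ℝ V]
    [IsEuclideanJordanAlgebra V] (g : V ≃ₗ[ℝ] V) (hg : g ∈ EuclideanJordan.coneAutGroup V)
    (p : ℝ) (hp : 1 < |p|) :
    ∃! a : V, a ∈ EuclideanJordan.symmetricCone V ∧ g a = EuclideanJordan.rpow a p := by
  open EuclideanJordan in
  have hp0 : p ≠ 0 := abs_pos.mp (one_pos.trans hp)
  have hgmem : ∀ z ∈ symmetricCone V, g z ∈ symmetricCone V := fun z hz => by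
    have hg' : (g : V → V) '' symmetricCone V = symmetricCone V := hg
    rw [← hg']
    exact Set.mem_image_of_mem _ hz
  have hq : |p⁻¹| < 1 := by rw [abs_inv]; exact inv_lt_one_of_one_lt₀ hp
  -- The exponent `p⁻¹` has absolute value below `1`, which is where `|p| > 1` enters.
  have h := existsUnique_fixedPoint_of_thompson (V := V) (F := fun a => rpow (g a) p⁻¹)
    (fun x hx => rpow_mem (hgmem x hx) _) (abs_pos.mpr (inv_ne_zero hp0)) hq
    fun a ha b hb t hab =>
      (hab.map (g : V →ₗ[ℝ] V) hgmem).rpow (hgmem a ha) (hgmem b hb) (inv_ne_zero hp0) hq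
  refine (existsUnique_congr fun a => and_congr_right fun ha => ?_).mp h
  constructor
  · intro h
    conv_rhs => rw [← h]
    rw [rpow_rpow (hgmem a ha), inv_mul_cancel₀ hp0, rpow_one']
  · intro h
    rw [h, rpow_rpow ha, mul_inv_cancel₀ hp0, rpow_one']
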